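/- Let $\mathcal{C}$ be a triangulated category with suspension functor $\Sigma$, and write $\operatorname{Ext}^1(X,Y)=\operatorname{Hom}_{\mathcal{C}}(X,\Sigma Y)$. For full subcategories $\mathcal{X},\mathcal{Y}\subseteq\mathcal{C}$ let $\mathcal{X}*\mathcal{Y}$ be the full subcategory of all objects $Z$ for which there is a distinguished triangle $X\to Z\to Y\to\Sigma X$ with $X\in\mathcal{X}$ and $Y\in\mathcal{Y}$. A *cotorsion pair* $(\mathcal{X},\mathcal{Y})$ on $\mathcal{C}$ consists of two full additive subcategories, closed under isomorphisms and direct summands, such that $\operatorname{Ext}^1(\mathcal{X},\mathcal{Y})=0$ and $\mathcal{C}=\mathcal{X}*\Sigma\mathcal{Y}$. Let $((\mathcal{S},\mathcal{T}),(\mathcal{U},\mathcal{V}))$ be a *twin cotorsion pair* on $\mathcal{C}$, i.e. $(\mathcal{S},\mathcal{T})$ and $(\mathcal{U},\mathcal{V})$ are cotorsion pairs on $\mathcal{C}$ with $\operatorname{Ext}^1(\mathcal{S},\mathcal{V})=0$. Put $$\mathcal{W}=\mathcal{T}\cap\mathcal{U},\qquad \mathcal{C}^-=\Sigma^{-1}\mathcal{S}*\mathcal{W},\qquad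 \mathcal{C}^+=\mathcal{W}*\Sigma\mathcal{V},\qquad \mathcal{H}=\mathcal{C}^-\cap\mathcal{C}^+,$$ and let the heart $\overline{\mathcal{H}}=\mathcal{H}/[\mathcal{W}]$ be the additive quotient of $\mathcal{H}$ by the ideal of all morphisms that factor through an object of $\mathcal{W}$. If $\mathcal{U}\subseteq\mathcal{T}$ or $\mathcal{T}\subseteq\mathcal{U}$, then $\overline{\mathcal{H}}$ is quasi-abelian; that is, $\overline{\mathcal{H}}$ is an additive category in which every morphism has a kernel and a cokernel, every pullback of a cokernel is a cokernel, and every pushout of a kernel is a kernel. -/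

import Mathlib

open CategoryTheory CategoryTheory.Limits CategoryTheory.Pretriangulated

universe v u

/-! ### Quasi-abelian categories -/

section QuasiAbelian

variable (A : Type u) [Category.{v} A] [Preadditive A]

/-- The class of all morphisms which are a kernel of some morphism. -/
def kernelMorphisms : MorphismProperty A := fun _ _ f => Nonempty (NormalMono f)

/-- The class of all morphisms which are a cokernel of some morphism. -/
def cokernelMorphisms : MorphismProperty A := fun _ _ f => Nonempty (NormalEpi f)

/-- A preabelian category: an additive category (a preadditive category with all finite
biproducts, the empty one being a zero object) with all kernels and cokernels. -/
structure IsPreabelian : Prop where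
  hasFiniteBiproducts : HasFiniteBiproducts A
  hasKernels : HasKernels A
  hasCokernels : HasCokernels A

/-- A quasi-abelian category: a preabelian category in which cokernels are stable under pullback
(left quasi-abelian) and kernels are stable under pushout (right quasi-abelian). -/
structure IsQuasiAbelian : Prop extends IsPreabelian A where
  cokernels_stable : (cokernelMorphisms A).IsStableUnderBaseChange
  kernels_stable : (kernelMorphisms A).IsStableUnderCobaseChange

end QuasiAbelian

/-! ### The ideal of morphisms factoring through a full subcategory -/

section Ideal

variable {C : Type u} [Category.{v} C]

/-- The morphism `f` factors through an object of `W`. -/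
def FactorsThroughObj (W : ObjectProperty C) {X Y : C} (f : X ⟶ Y) : Prop :=
  ∃ (Z : C) (_ : W Z) (i : X ⟶ Z) (p : Z ⟶ Y), i ≫ p = f

variable {W : ObjectProperty C}

lemma FactorsThroughObj.precomp {X' X Y : C} {f : X ⟶ Y} (h : FactorsThroughObj W f)
    (g : X' ⟶ X) : FactorsThroughObj W (g ≫ f) := by
  obtain ⟨Z, hZ, i, p, rfl⟩ := h
  exact ⟨Z, hZ, g ≫ i, p, by simp⟩

lemma FactorsThroughObj.postcomp {X Y Y' : C} {f : X ⟶ Y} (h : FactorsThroughObj W f)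
    (g : Y ⟶ Y') : FactorsThroughObj W (f ≫ g) := by
  obtain ⟨Z, hZ, i, p, rfl⟩ := h
  exact ⟨Z, hZ, i, p ≫ g, by simp⟩

variable [Preadditive C]

lemma FactorsThroughObj.zero [W.ContainsZero] (X Y : C) :
    FactorsThroughObj W (0 : X ⟶ Y) := by
  obtain ⟨Z, _, hZ⟩ := W.exists_prop_of_containsZero
  exact ⟨Z, hZ, 0, 0, by simp⟩

lemma FactorsThroughObj.neg {X Y : C} {f : X ⟶ Y} (h : FactorsThroughObj W f) :
    FactorsThroughObj W (-f) := by
  obtain ⟨Z, hZ, i, p, rfl⟩ := h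
  exact ⟨Z, hZ, -i, p, by simp⟩

lemma FactorsThroughObj.add [HasBinaryBiproducts C] [W.IsClosedUnderBinaryProducts]
    {X Y : C} {f g : X ⟶ Y} (hf : FactorsThroughObj W f) (hg : FactorsThroughObj W g) :
    FactorsThroughObj W (f + g) := by
  obtain ⟨Z, hZ, i, p, rfl⟩ := hf
  obtain ⟨Z', hZ', i', p', rfl⟩ := hg
  exact ⟨Z ⊞ Z', W.prop_of_isLimit_binaryFan (BinaryBiproduct.isLimit Z Z') hZ hZ',
    biprod.lift i i', biprod.desc p p', by simp⟩

/-- The congruence on the full subcategory `H` of `C` given by the ideal `[W]` of `C`: two parallel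
morphisms are identified if their difference factors (in `C`) through an object of `W`. -/
def idealRel (H W : ObjectProperty C) : HomRel H.FullSubcategory :=
  fun _ _ f g => FactorsThroughObj W (f.hom - g.hom)

variable [HasBinaryBiproducts C] (H : ObjectProperty C)

lemma idealRel_congruence [W.ContainsZero] [W.IsClosedUnderBinaryProducts] :
    Congruence (idealRel H W) where
  equivalence :=
    { refl := fun f => by simpa [idealRel] using FactorsThroughObj.zero _ _
      symm := fun {f g} h => by simpa [idealRel] using FactorsThroughObj.neg h
      trans := fun {f g k} h h' => by simpa [idealRel] using FactorsThroughObj.add h h' }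
  comp_left f g g' h := by
    simpa [idealRel, Preadditive.comp_sub] using FactorsThroughObj.precomp h f.hom
  comp_right g h := by
    simpa [idealRel, Preadditive.sub_comp] using FactorsThroughObj.postcomp h g.hom

lemma idealRel_add [W.IsClosedUnderBinaryProducts] ⦃X Y : H.FullSubcategory⦄
    (f₁ f₂ g₁ g₂ : X ⟶ Y) (hf : idealRel H W f₁ f₂) (hg : idealRel H W g₁ g₂) :
    idealRel H W (f₁ + g₁) (f₂ + g₂) := by
  have := FactorsThroughObj.add hf hg
  rwa [sub_add_sub_comm] at this

end Ideal

/-! ### Twin cotorsion pairs -/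

section TwinCotorsion

variable {C : Type u} [Category.{v} C] [Preadditive C] [HasZeroObject C] [HasShift C ℤ]
  [∀ n : ℤ, (shiftFunctor C n).Additive] [Pretriangulated C]

/-- A full additive subcategory closed under isomorphisms and direct summands. (In a triangulated
category every retract is a direct summand; stability under retracts contains closure
under isomorphisms.) -/
structure IsAdditiveSubcategory (P : ObjectProperty C) : Prop where
  containsZero : P.ContainsZero
  closedUnderSums : P.IsClosedUnderBinaryProducts
  closedUnderSummands : P.IsStableUnderRetracts

/-- `(U, V)` is a cotorsion pair on `C`: `Ext¹(U, V) = Hom(U, ΣV) = 0` and `C = U * ΣV`.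
Here `P.shift n` consists of the objects `X` such that `X⟦n⟧` satisfies `P`, so that `ΣV` is
`V.shift (-1)`, and `extensionProduct U V` is `U * V`. -/
structure IsCotorsionPair (U V : ObjectProperty C) : Prop where
  left_additive : IsAdditiveSubcategory U
  right_additive : IsAdditiveSubcategory V
  ext_one_eq_zero : ∀ ⦃X Y : C⦄, U X → V Y → ∀ f : X ⟶ Y⟦(1 : ℤ)⟧, f = 0
  extensionProduct_eq_top : U.extensionProduct (V.shift (-1 : ℤ)) = ⊤

variable (C) in
/-- A twin cotorsion pair `((S, T), (U, V))` on `C`: cotorsion pairs `(S, T)` and `(U, V)` with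
`Ext¹(S, V) = 0`. -/
structure TwinCotorsionPair where
  S : ObjectProperty C
  T : ObjectProperty C
  U : ObjectProperty C
  V : ObjectProperty C
  isCotorsionPair_left : IsCotorsionPair S T
  isCotorsionPair_right : IsCotorsionPair U V
  ext_one_eq_zero : ∀ ⦃X Y : C⦄, S X → V Y → ∀ f : X ⟶ Y⟦(1 : ℤ)⟧, f = 0

namespace TwinCotorsionPair

variable (P : TwinCotorsionPair C)

/-- `W = T ∩ U`. -/
def W : ObjectProperty C := P.T ⊓ P.U

/-- `C⁻ = Σ⁻¹S * W`. -/
def CMinus : ObjectProperty C := (P.S.shift (1 : ℤ)).extensionProduct P.W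

/-- `C⁺ = W * ΣV`. -/
def CPlus : ObjectProperty C := P.W.extensionProduct (P.V.shift (-1 : ℤ))

/-- `H = C⁻ ∩ C⁺`. -/
def H : ObjectProperty C := P.CMinus ⊓ P.CPlus

instance W_containsZero : P.W.ContainsZero := by
  have := P.isCotorsionPair_left.right_additive.containsZero
  have := P.isCotorsionPair_right.left_additive.containsZero
  have := P.isCotorsionPair_right.left_additive.closedUnderSummands
  unfold W
  infer_instance

instance W_closedUnderSums : P.W.IsClosedUnderBinaryProducts := by
  have := P.isCotorsionPair_left.right_additive.closedUnderSums
  have := P.isCotorsionPair_right.left_additive.closedUnderSums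
  refine ⟨fun X hX => ?_⟩
  obtain ⟨p, hp⟩ := hX
  exact ⟨P.T.prop_of_isLimit p.isLimit fun j => (hp j).1,
    P.U.prop_of_isLimit p.isLimit fun j => (hp j).2⟩

instance congruence : Congruence (idealRel P.H P.W) := idealRel_congruence P.H

/-- The heart `H/[W]` of the twin cotorsion pair: the quotient of the full subcategory `H` by the
ideal of morphisms factoring through an object of `W`. -/
abbrev Heart := CategoryTheory.Quotient (idealRel P.H P.W)

/-- The addition of morphisms in the heart is induced by the addition in `C`. -/
instance heartPreadditive : Preadditive P.Heart :=
  CategoryTheory.Quotient.preadditive _ (idealRel_add P.H)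

end TwinCotorsionPair

end TwinCotorsion

/-! ### Kernels and cokernels in a preadditive category: duality and a criterion. -/

section QuasiAbelianCriteria

variable {A : Type u} [Category.{v} A] [Preadditive A]

/-! If `U ⊆ T`, then `W = U` and `C⁺ = U * ΣV = C`, so with `R = Σ⁻¹S` the heart is `(R * U)/[U]`.
What is used of the twin pair is recorded in `IsNestedTorsionPair`: every object is an extension for
both `(R, T)` and `(U, ΣV)`, with the matching Hom-vanishing; `Hom(R, U) = 0` because `U ⊆ T`; and
`Hom(ΣR, ΣV) = 0`, which puts `ΣR` inside `U`. The case `T ⊆ U` is the same statement in the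
opposite category.

Restricting a morphism to the `R`-part of its source and taking the cone gives its cokernel
(`exists_cokernel`). The fibre of its composite to the `ΣV`-part of the target, approximated by an
object of `R * U`, gives its kernel (`exists_kernel`). Cokernels thus come from triangles, and their
pullbacks are retracts of homotopy pullbacks, which are again such cokernels
(`cokernelMorphisms_of_isPullback_map`). Given this, `kernelMorphisms_isStableUnderCobaseChange`
reduces stability of kernels to pushouts of kernels being monomorphisms, which is the chase in
`mono_of_isPushout`. -/

lemma cokernelMorphisms_iff {X Y : A} (f : X ⟶ Y) :
    cokernelMorphisms A f ↔ Epi f ∧ ∃ (W : A) (g : W ⟶ X), g ≫ f = 0 ∧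
      ∀ ⦃Z : A⦄ (k : X ⟶ Z), g ≫ k = 0 → ∃ l : Y ⟶ Z, f ≫ l = k := by
  constructor
  · rintro ⟨h⟩
    exact ⟨inferInstance, h.W, h.g, h.w, fun Z k hk =>
      ⟨(NormalEpi.desc' f k hk).1, (NormalEpi.desc' f k hk).2⟩⟩
  · rintro ⟨_, W, g, w, hd⟩
    refine ⟨⟨W, g, w, CokernelCofork.IsColimit.ofπ f w (fun k hk => (hd k hk).choose)
      (fun k hk => (hd k hk).choose_spec) (fun k hk m hm => ?_)⟩⟩
    rw [← cancel_epi f, hm, (hd k hk).choose_spec]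

lemma cokernelMorphisms_of_epi_comp {X Y Z : A} (e : X ⟶ Y) (f : Y ⟶ Z) [Epi e]
    (h : cokernelMorphisms A (e ≫ f)) : cokernelMorphisms A f := by
  rw [cokernelMorphisms_iff] at h ⊢
  obtain ⟨_, W, g, w, hd⟩ := h
  refine ⟨epi_of_epi e f, W, g ≫ e, by simpa using w, fun T k hk => ?_⟩
  obtain ⟨l, hl⟩ := hd (e ≫ k) (by simpa using hk)
  exact ⟨l, by rw [← cancel_epi e, ← hl, Category.assoc]⟩

lemma kernelMorphisms_op {X Y : A} {f : X ⟶ Y} (h : kernelMorphisms A f) :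
    cokernelMorphisms Aᵒᵖ f.op := by
  obtain ⟨h⟩ := h
  exact ⟨normalEpiOfNormalMonoUnop f.op h⟩

lemma cokernelMorphisms_op {X Y : A} {f : X ⟶ Y} (h : cokernelMorphisms A f) :
    kernelMorphisms Aᵒᵖ f.op := by
  obtain ⟨h⟩ := h
  exact ⟨normalMonoOfNormalEpiUnop f.op h⟩

lemma kernelMorphisms_of_op {X Y : A} {f : X ⟶ Y} (h : cokernelMorphisms Aᵒᵖ f.op) :
    kernelMorphisms A f := by
  obtain ⟨_, W, g, w, hd⟩ := (cokernelMorphisms_iff _).1 h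
  have : Mono f := (inferInstance : Mono f.op.unop)
  refine ⟨⟨W.unop, g.unop, Quiver.Hom.op_inj w, KernelFork.IsLimit.ofι f (Quiver.Hom.op_inj w)
    (fun k hk => (hd k.op (Quiver.Hom.unop_inj hk)).choose.unop)
    (fun k hk => Quiver.Hom.op_inj (hd k.op (Quiver.Hom.unop_inj hk)).choose_spec)
    (fun k hk m hm => ?_)⟩⟩
  rw [← cancel_mono f, hm]
  exact (Quiver.Hom.op_inj (hd k.op (Quiver.Hom.unop_inj hk)).choose_spec).symm

lemma cokernelMorphisms_of_op {X Y : A} {f : X ⟶ Y} (h : kernelMorphisms Aᵒᵖ f.op) :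
    cokernelMorphisms A f := by
  obtain ⟨⟨W, g, w, hl⟩⟩ := h
  have : Mono f.op := ⟨fun a b hab => Fork.IsLimit.hom_ext hl hab⟩
  have : Epi f := (inferInstance : Epi f.op.unop)
  refine (cokernelMorphisms_iff _).2 ⟨this, W.unop, g.unop, Quiver.Hom.op_inj w, fun Z k hk => ?_⟩
  obtain ⟨l, hl⟩ := KernelFork.IsLimit.lift' hl k.op (Quiver.Hom.unop_inj hk)
  exact ⟨l.unop, Quiver.Hom.op_inj hl⟩

lemma IsQuasiAbelian.of_op (h : IsQuasiAbelian Aᵒᵖ) : IsQuasiAbelian A := by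
  have := h.hasFiniteBiproducts
  have := h.hasKernels
  have := h.hasCokernels
  have := h.cokernels_stable
  have := h.kernels_stable
  have : HasFiniteProducts A := hasFiniteProducts_of_opposite
  exact
    { hasFiniteBiproducts := HasFiniteBiproducts.of_hasFiniteProducts
      hasKernels := ⟨fun {X Y} f => by
        let t := cokernelIsCokernel f.op
        exact ⟨_, CokernelCofork.IsColimit.ofπUnop (f := f.op) _ (cokernel.condition f.op) t⟩⟩
      hasCokernels := ⟨fun {X Y} f => by
        let t := kernelIsKernel f.op
        exact ⟨_, KernelFork.IsLimit.ofιUnop (f := f.op) _ (kernel.condition f.op) t⟩⟩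
      cokernels_stable := ⟨fun sq hg => cokernelMorphisms_of_op
        (MorphismProperty.of_isPushout sq.op (cokernelMorphisms_op hg))⟩
      kernels_stable := ⟨fun sq hg => kernelMorphisms_of_op
        (MorphismProperty.of_isPullback sq.op (kernelMorphisms_op hg))⟩ }

/-- If cokernels are stable under pullback, then kernels are stable under pushout as soon as
the pushouts of kernels are monomorphisms. -/
lemma kernelMorphisms_isStableUnderCobaseChange [HasBinaryBiproducts A] [HasKernels A]
    [HasCokernels A] [(cokernelMorphisms A).IsStableUnderBaseChange]
    (H : ∀ ⦃K B X P : A⦄ {k : K ⟶ B} {g : K ⟶ X} {a : B ⟶ P} {x : X ⟶ P},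
      IsPushout k g a x → kernelMorphisms A k → Mono x) :
    (kernelMorphisms A).IsStableUnderCobaseChange := by
  refine ⟨fun {K B X P} k g x a sq hk => ?_⟩
  have sq := sq.flip
  have hx := H sq hk
  obtain ⟨hk⟩ := hk
  let c : P ⟶ cokernel k := sq.desc (cokernel.π k) 0 (by simp)
  have hac : a ≫ c = cokernel.π k := sq.inl_desc _ _ _
  have hxc : x ≫ c = 0 := sq.inr_desc _ _ _
  let m : X ⟶ kernel c := kernel.lift c x hxc
  have hm : m ≫ kernel.ι c = x := kernel.lift_ι _ _ _
  -- The pushout property says that `(a, x)` is the cokernel of `(k, -g)`.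
  have hπ : cokernelMorphisms A (biprod.desc a x) := by
    refine (cokernelMorphisms_iff _).2 ⟨⟨fun u v huv => ?_⟩, K, biprod.lift k (-g), ?_, ?_⟩
    · apply sq.hom_ext
      · simpa using congr(biprod.inl ≫ $huv)
      · simpa using congr(biprod.inr ≫ $huv)
    · simp [sq.w]
    · intro Z f hf
      rw [biprod.lift_eq] at hf
      refine ⟨sq.desc (biprod.inl ≫ f) (biprod.inr ≫ f) ?_, ?_⟩
      · simpa [add_neg_eq_zero] using hf
      · ext <;> simp
  have hmono : Mono (biprod.map k (𝟙 X)) := ⟨fun u v huv => by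
    ext
    · rw [← cancel_mono k]
      simpa using congr($huv ≫ biprod.fst)
    · simpa using congr($huv ≫ biprod.snd)⟩
  -- A map to `B ⊞ X` killed in `cokernel k` has its `B`-component in `K`, as `k` is a kernel. So
  -- pulling `(a, x)` back to `kernel c` gives `K ⊞ X`.
  have hpb : IsPullback (biprod.map k (𝟙 X)) (biprod.desc (g ≫ m) m) (biprod.desc a x)
      (kernel.ι c) := by
    have hl : ∀ s : PullbackCone (biprod.desc a x) (kernel.ι c),
        ∃ l, l ≫ k = s.fst ≫ biprod.fst := fun s => by
      have hs := s.condition =≫ c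
      have hac' : biprod.desc a x ≫ c = biprod.fst ≫ cokernel.π k := by
        ext <;> simp [hac, hxc]
      rw [Category.assoc, hac', Category.assoc, kernel.condition, comp_zero] at hs
      refine ⟨_, (NormalMono.lift' k (s.fst ≫ biprod.fst) ?_).2⟩
      rw [← cokernel.π_desc k hk.g hk.w, Category.assoc, reassoc_of% hs, zero_comp]
    have hw : biprod.map k (𝟙 X) ≫ biprod.desc a x = biprod.desc (g ≫ m) m ≫ kernel.ι c := by
      ext <;> simp [hm, sq.w]
    have hfst : ∀ s : PullbackCone (biprod.desc a x) (kernel.ι c),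
        biprod.lift (hl s).choose (s.fst ≫ biprod.snd) ≫ biprod.map k (𝟙 X) = s.fst := fun s => by
      ext
      · simp [(hl s).choose_spec]
      · simp
    exact ⟨⟨hw⟩, ⟨PullbackCone.IsLimit.mk _ _ hfst
      (fun s => by rw [← cancel_mono (kernel.ι c), Category.assoc, ← hw, reassoc_of% (hfst s),
        s.condition])
      (fun s u hu _ => by rw [← cancel_mono (biprod.map k (𝟙 X)), hu, hfst s])⟩⟩
  have htop := MorphismProperty.of_isPullback hpb hπ
  -- The pulled back cokernel is `(g, 1) ≫ m` with `(g, 1)` split epi, so `m` is a cokernel; being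
  -- also mono, it identifies `x` with `kernel.ι c`.
  have hm' : cokernelMorphisms A m := by
    have h1 : biprod.desc (g ≫ m) m = biprod.desc g (𝟙 X) ≫ m := by ext <;> simp
    have : Epi (biprod.desc g (𝟙 X)) := by
      have : IsSplitEpi (biprod.desc g (𝟙 X)) := ⟨⟨⟨biprod.inr, by simp⟩⟩⟩
      infer_instance
    rw [h1] at htop
    exact cokernelMorphisms_of_epi_comp _ _ htop
  obtain ⟨hm'⟩ := hm'
  have : Mono m := by
    rw [← hm] at hx
    exact mono_of_mono m (kernel.ι c)
  have : IsIso m := isIso_of_mono_of_strongEpi m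
  refine ⟨⟨_, c, hxc, KernelFork.IsLimit.ofι x hxc (fun k' hk' => kernel.lift c k' hk' ≫ inv m)
    (fun k' hk' => by rw [← hm]; simp) (fun k' hk' l hl => ?_)⟩⟩
  rw [← cancel_mono x, hl, ← hm]
  simp

end QuasiAbelianCriteria

open scoped ZeroObject

/-! ### Torsion-like pairs and the extension subcategory `R * U`. -/

section WeakTorsionPair

variable {C : Type u} [Category.{v} C] [Preadditive C] [HasZeroObject C] [HasShift C ℤ]
  [∀ n : ℤ, (shiftFunctor C n).Additive] [Pretriangulated C]

lemma CategoryTheory.ObjectProperty.extensionProduct_of_shift {P Q : ObjectProperty C}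
    [P.IsClosedUnderIsomorphisms] [Q.IsClosedUnderIsomorphisms] (n : ℤ) {X : C}
    (h : P.extensionProduct Q (X⟦n⟧)) : (P.shift n).extensionProduct (Q.shift n) X := by
  obtain ⟨Y, Z, f, g, δ, hT, hY, hZ⟩ := h
  refine ObjectProperty.prop_of_iso _ ((shiftEquiv C n).unitIso.app X).symm
    ⟨_, _, _, _, _, Triangle.shift_distinguished _ hT (-n), ?_, ?_⟩
  · exact P.prop_of_iso ((shiftEquiv C n).counitIso.app Y).symm hY
  · exact Q.prop_of_iso ((shiftEquiv C n).counitIso.app Z).symm hZ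

/-- A pair `(P, Q)` of full subcategories closed under retracts such that `Hom(P, Q) = 0` and
`C = P * Q`. -/
structure IsWeakTorsionPair (P Q : ObjectProperty C) : Prop where
  left_retracts : P.IsStableUnderRetracts
  right_retracts : Q.IsStableUnderRetracts
  hom_eq_zero : ∀ ⦃X Y : C⦄, P X → Q Y → ∀ f : X ⟶ Y, f = 0
  extensionProduct_eq_top : P.extensionProduct Q = ⊤

namespace IsWeakTorsionPair

variable {P Q : ObjectProperty C} (h : IsWeakTorsionPair P Q)

include h

lemma exists_triangle (X : C) : ∃ (Y Z : C) (f : Y ⟶ X) (g : X ⟶ Z) (δ : Z ⟶ Y⟦(1 : ℤ)⟧),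
    Triangle.mk f g δ ∈ distTriang C ∧ P Y ∧ Q Z := by
  have : P.extensionProduct Q X := by simp [h.extensionProduct_eq_top]
  exact this

/-- In the approximating triangle `Y ⟶ X ⟶ Z` the second map vanishes, so `X` is a retract of `Y`.
-/
lemma left_of_hom_eq_zero {X : C} (hX : ∀ ⦃Y : C⦄, Q Y → ∀ f : X ⟶ Y, f = 0) : P X := by
  obtain ⟨Y, Z, f, g, δ, hT, hY, hZ⟩ := h.exists_triangle X
  obtain ⟨s, hs⟩ := Triangle.coyoneda_exact₂ _ hT (𝟙 X) ((Category.id_comp _).trans (hX hZ g))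
  have := h.left_retracts
  exact P.prop_of_retract ⟨s, f, hs.symm⟩ hY

lemma right_of_hom_eq_zero {Y : C} (hY : ∀ ⦃X : C⦄, P X → ∀ f : X ⟶ Y, f = 0) : Q Y := by
  obtain ⟨X, Z, f, g, δ, hT, hX, hZ⟩ := h.exists_triangle Y
  obtain ⟨s, hs⟩ := Triangle.yoneda_exact₂ _ hT (𝟙 Y) ((Category.comp_id _).trans (hY hX f))
  have := h.right_retracts
  exact Q.prop_of_retract ⟨g, s, hs.symm⟩ hZ

lemma left_of_isZero {X : C} (hX : IsZero X) : P X :=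
  h.left_of_hom_eq_zero fun _ _ _ => hX.eq_of_src _ _

lemma left_biprod {X Y : C} (hX : P X) (hY : P Y) : P (X ⊞ Y) :=
  h.left_of_hom_eq_zero fun Z hZ f => by
    ext
    · simpa using h.hom_eq_zero hX hZ (biprod.inl ≫ f)
    · simpa using h.hom_eq_zero hY hZ (biprod.inr ≫ f)

lemma extensionProduct_left_le : P.extensionProduct P ≤ P := by
  rintro X ⟨Y, Z, f, g, δ, hT, hY, hZ⟩
  refine h.left_of_hom_eq_zero fun W hW m => ?_
  obtain ⟨n, rfl⟩ := Triangle.yoneda_exact₂ _ hT m (h.hom_eq_zero hY hW _)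
  have := h.hom_eq_zero hZ hW n
  subst this
  exact comp_zero

end IsWeakTorsionPair

/-- Two weak torsion pairs `(R, T)` and `(U, V)` with `U ⊆ T` and `Hom(ΣR, V) = 0`. -/
structure IsNestedTorsionPair (R T U V : ObjectProperty C) : Prop where
  left : IsWeakTorsionPair R T
  right : IsWeakTorsionPair U V
  le : U ≤ T
  hom_shift_eq_zero : ∀ ⦃X Y : C⦄, R X → V Y → ∀ f : X⟦(1 : ℤ)⟧ ⟶ Y, f = 0

namespace IsNestedTorsionPair

variable {R T U V : ObjectProperty C} (h : IsNestedTorsionPair R T U V)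

include h

lemma hom_RU {X Y : C} (hX : R X) (hY : U Y) (f : X ⟶ Y) : f = 0 :=
  h.left.hom_eq_zero hX (h.le _ hY) f

lemma hom_UV {X Y : C} (hX : U X) (hY : V Y) (f : X ⟶ Y) : f = 0 :=
  h.right.hom_eq_zero hX hY f

/-- Hence morphisms factoring through the connecting map of a triangle starting in `R` vanish modulo
`U`. -/
lemma shift_left {X : C} (hX : R X) : U (X⟦(1 : ℤ)⟧) :=
  h.right.left_of_hom_eq_zero fun _ hY f => h.hom_shift_eq_zero hX hY f

lemma shift_right {Y : C} (hY : V Y) : T (Y⟦(-1 : ℤ)⟧) := by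
  refine h.left.right_of_hom_eq_zero fun X hX f => ?_
  apply (shiftFunctor C (1 : ℤ)).map_injective
  rw [Functor.map_zero, ← cancel_mono (shiftNegShift Y (1 : ℤ)).hom, zero_comp]
  exact h.hom_shift_eq_zero hX hY _

lemma R_le : R ≤ R.extensionProduct U := fun X hX =>
  ⟨X, 0, 𝟙 X, 0, 0, contractible_distinguished X, hX, h.right.left_of_isZero (isZero_zero C)⟩

lemma U_le : U ≤ R.extensionProduct U := fun X hX =>
  ⟨0, X, 0, 𝟙 X, 0, contractible_distinguished₁ X, h.left.left_of_isZero (isZero_zero C), hX⟩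

/-- An object belongs to `R * U` as soon as it admits a morphism from an object of `R` which is
an epimorphism with respect to morphisms to objects of `V`. -/
lemma extensionProduct_of_hom {X M : C} (hX : R X) (s : X ⟶ M)
    (hs : ∀ ⦃Y : C⦄, V Y → ∀ m : M ⟶ Y, s ≫ m = 0 → m = 0) : R.extensionProduct U M := by
  obtain ⟨Z, w, δ, hT⟩ := distinguished_cocone_triangle s
  -- The cone has no maps to `V`: such a map vanishes on `M` by `hs`, so it factors through `ΣX`,
  -- and `Hom(ΣR, V) = 0`.
  refine ⟨X, Z, s, w, δ, hT, hX, h.right.left_of_hom_eq_zero fun Y hY m => ?_⟩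
  have hsw : s ≫ w = 0 := comp_distTriang_mor_zero₁₂ _ hT
  obtain ⟨n, rfl⟩ := Triangle.yoneda_exact₃ _ hT m
    (hs hY (w ≫ m) (by rw [reassoc_of% hsw, zero_comp]))
  have := h.hom_shift_eq_zero hX hY n
  subst this
  exact comp_zero

lemma eq_zero_of_triangle {X M Z Y : C} {s : X ⟶ M} {w : M ⟶ Z} {δ : Z ⟶ X⟦(1 : ℤ)⟧}
    (hT : Triangle.mk s w δ ∈ distTriang C) (hZ : U Z) (hY : V Y) (m : M ⟶ Y)
    (hm : s ≫ m = 0) : m = 0 := by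
  obtain ⟨n, rfl⟩ := Triangle.yoneda_exact₂ _ hT m hm
  have := h.hom_UV hZ hY n
  subst this
  exact comp_zero

lemma biprod_mem {X Y : C} (hX : R.extensionProduct U X) (hY : R.extensionProduct U Y) :
    R.extensionProduct U (X ⊞ Y) := by
  obtain ⟨X', X'', s, w, δ, hT, hX', hX''⟩ := hX
  obtain ⟨Y', Y'', s', w', δ', hT', hY', hY''⟩ := hY
  refine h.extensionProduct_of_hom (h.left.left_biprod hX' hY') (biprod.map s s')
    fun Z hZ m hm => ?_
  ext
  · simpa using h.eq_zero_of_triangle hT hX'' hZ (biprod.inl ≫ m)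
      (by simpa using biprod.inl ≫= hm)
  · simpa using h.eq_zero_of_triangle hT' hY'' hZ (biprod.inr ≫ m)
      (by simpa using biprod.inr ≫= hm)

/-- The `R`-approximation of `B`, followed by `c`, still detects maps to `V`, because `Hom(ΣR, V) =
0`. -/
lemma cone_mem {X B K : C} {r : X ⟶ B} {c : B ⟶ K} {δ : K ⟶ X⟦(1 : ℤ)⟧}
    (hT : Triangle.mk r c δ ∈ distTriang C) (hX : R X) (hB : R.extensionProduct U B) :
    R.extensionProduct U K := by
  obtain ⟨X', X'', s, w, δ', hT', hX', hX''⟩ := hB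
  refine h.extensionProduct_of_hom hX' (s ≫ c) fun Z hZ m hm => ?_
  obtain ⟨n, rfl⟩ := Triangle.yoneda_exact₃ _ hT m
    (h.eq_zero_of_triangle hT' hX'' hZ _ ((Category.assoc _ _ _).symm.trans hm))
  have := h.hom_shift_eq_zero hX hZ n
  subst this
  exact comp_zero

/-- By associativity, `R * (R * U) = (R * R) * U ⊆ R * U`. -/
lemma extension_mem [IsTriangulated C] {X Y Z : C} {r : X ⟶ Y} {c : Y ⟶ Z} {δ : Z ⟶ X⟦(1 : ℤ)⟧}
    (hT : Triangle.mk r c δ ∈ distTriang C) (hX : R X) (hZ : R.extensionProduct U Z) :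
    R.extensionProduct U Y := by
  refine ObjectProperty.monotone_extensionProduct_left U h.left.extensionProduct_left_le _ ?_
  rw [ObjectProperty.extensionProduct_assoc]
  exact ⟨X, Z, r, c, δ, hT, hX, hZ⟩

/-- Every object `M` admits a morphism `K ⟶ M` from an object of `R * U` with cone in `V`, such
that the morphism from `M` to the cone kills all morphisms from objects of `R`. -/
lemma exists_approximation [IsTriangulated C] (M : C) :
    ∃ (K Y : C) (j : K ⟶ M) (m : M ⟶ Y) (δ : Y ⟶ K⟦(1 : ℤ)⟧),
      Triangle.mk j m δ ∈ distTriang C ∧ R.extensionProduct U K ∧ V Y ∧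
        ∀ ⦃X : C⦄, R X → ∀ r : X ⟶ M, r ≫ m = 0 := by
  obtain ⟨X, T₀, s, p, δ, hT, hX, hT₀⟩ := h.left.exists_triangle M
  obtain ⟨U₀, Y, i, q, ε, hT', hU₀, hY⟩ := h.right.exists_triangle T₀
  obtain ⟨K, j, η, hK⟩ := distinguished_cocone_triangle₁ (p ≫ q)
  refine ⟨K, Y, j, p ≫ q, η, hK, ?_, hY, fun X' hX' r => ?_⟩
  · have := h.left.left_retracts
    have := h.right.left_retracts
    -- The fibre of `M ⟶ T₀ ⟶ Y` is an extension of the two fibres `X` in `R` and `U₀` in `U`. The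
    -- rotated triangles give this after one suspension, which is then undone.
    let o := Triangulated.someOctahedron (rfl : p ≫ q = p ≫ q) (rot_of_distTriang _ hT)
      (rot_of_distTriang _ hT') (rot_of_distTriang _ hK)
    have H : (R.shift (-1 : ℤ)).extensionProduct (U.shift (-1 : ℤ)) (K⟦(1 : ℤ)⟧) :=
      ⟨_, _, _, _, _, o.mem, R.prop_of_iso ((shiftEquiv C (1 : ℤ)).unitIso.app X) hX,
        U.prop_of_iso ((shiftEquiv C (1 : ℤ)).unitIso.app U₀) hU₀⟩
    have := ObjectProperty.extensionProduct_of_shift 1 H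
    rwa [ObjectProperty.shift_shift _ (1 : ℤ) (-1) 0 (by simp),
      ObjectProperty.shift_shift _ (1 : ℤ) (-1) 0 (by simp),
      ObjectProperty.shift_zero, ObjectProperty.shift_zero] at this
  · rw [← Category.assoc, h.left.hom_eq_zero hX' hT₀ (r ≫ p), zero_comp]

end IsNestedTorsionPair

end WeakTorsionPair

/-! ### Long exact Hom sequences of a distinguished triangle. -/

section Exactness

variable {C : Type u} [Category.{v} C] [Preadditive C] [HasZeroObject C] [HasShift C ℤ]
  [∀ n : ℤ, (shiftFunctor C n).Additive] [Pretriangulated C]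
  {X Y Z W : C} {f : X ⟶ Y} {g : Y ⟶ Z} {δ : Z ⟶ X⟦(1 : ℤ)⟧}

namespace DistTriang

lemma exists_lift₁ (hT : Triangle.mk f g δ ∈ distTriang C) (p : W ⟶ Y) (hp : p ≫ g = 0) :
    ∃ q : W ⟶ X, q ≫ f = p :=
  let ⟨q, hq⟩ := Triangle.coyoneda_exact₂ _ hT p hp
  ⟨q, hq.symm⟩

lemma exists_lift₂ (hT : Triangle.mk f g δ ∈ distTriang C) (p : W ⟶ Z) (hp : p ≫ δ = 0) :
    ∃ q : W ⟶ Y, q ≫ g = p :=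
  let ⟨q, hq⟩ := Triangle.coyoneda_exact₃ _ hT p hp
  ⟨q, hq.symm⟩

lemma exists_lift₃ (hT : Triangle.mk f g δ ∈ distTriang C) (p : W ⟶ X⟦(1 : ℤ)⟧)
    (hp : p ≫ f⟦(1 : ℤ)⟧' = 0) : ∃ q : W ⟶ Z, q ≫ δ = p :=
  let ⟨q, hq⟩ := Triangle.coyoneda_exact₁ _ hT p hp
  ⟨q, hq.symm⟩

lemma exists_desc₂ (hT : Triangle.mk f g δ ∈ distTriang C) (p : Y ⟶ W) (hp : f ≫ p = 0) :
    ∃ q : Z ⟶ W, g ≫ q = p :=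
  let ⟨q, hq⟩ := Triangle.yoneda_exact₂ _ hT p hp
  ⟨q, hq.symm⟩

lemma exists_desc₃ (hT : Triangle.mk f g δ ∈ distTriang C) (p : Z ⟶ W) (hp : g ≫ p = 0) :
    ∃ q : X⟦(1 : ℤ)⟧ ⟶ W, δ ≫ q = p :=
  let ⟨q, hq⟩ := Triangle.yoneda_exact₃ _ hT p hp
  ⟨q, hq.symm⟩

lemma comp₁₂ (hT : Triangle.mk f g δ ∈ distTriang C) : f ≫ g = 0 :=
  comp_distTriang_mor_zero₁₂ _ hT

lemma comp₂₃ (hT : Triangle.mk f g δ ∈ distTriang C) : g ≫ δ = 0 :=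
  comp_distTriang_mor_zero₂₃ _ hT

lemma comp₃₁ (hT : Triangle.mk f g δ ∈ distTriang C) : δ ≫ f⟦(1 : ℤ)⟧' = 0 :=
  comp_distTriang_mor_zero₃₁ _ hT

lemma exists_hom₂ {Y' Z' : C} {f' : X ⟶ Y'} {g' : Y' ⟶ Z'} {δ' : Z' ⟶ X⟦(1 : ℤ)⟧}
    (hT : Triangle.mk f g δ ∈ distTriang C) (hT' : Triangle.mk f' g' δ' ∈ distTriang C)
    (c : Z ⟶ Z') (hc : c ≫ δ' = δ) : ∃ b : Y ⟶ Y', f ≫ b = f' ∧ g ≫ c = b ≫ g' := by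
  have hc' : δ ≫ (𝟙 X)⟦(1 : ℤ)⟧' = c ≫ δ' := by
    rw [CategoryTheory.Functor.map_id, Category.comp_id, hc]
  obtain ⟨b, hb, hb'⟩ := complete_distinguished_triangle_morphism₂ _ _ hT hT' (𝟙 X) c
    hc'
  exact ⟨b, hb.trans (Category.id_comp _), hb'⟩

lemma exists_hom₃ {Y' Z' : C} {f' : X ⟶ Y'} {g' : Y' ⟶ Z'} {δ' : Z' ⟶ X⟦(1 : ℤ)⟧}
    (hT : Triangle.mk f g δ ∈ distTriang C) (hT' : Triangle.mk f' g' δ' ∈ distTriang C)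
    (b : Y ⟶ Y') (hb : f ≫ b = f') : ∃ c : Z ⟶ Z', g ≫ c = b ≫ g' ∧ c ≫ δ' = δ := by
  obtain ⟨c, hc, hc'⟩ : ∃ c : Z ⟶ Z', g ≫ c = b ≫ g' ∧ δ ≫ (𝟙 X)⟦(1 : ℤ)⟧' = c ≫ δ' :=
    complete_distinguished_triangle_morphism _ _ hT hT' (𝟙 X) b
      (hb.trans (Category.id_comp _).symm)
  rw [CategoryTheory.Functor.map_id, Category.comp_id] at hc'
  exact ⟨c, hc, hc'.symm⟩

end DistTriang

end Exactness

/-! ### Kernels and cokernels in `(R * U)/[U]`. -/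

section IdealQuotient

/-- The functor `F` exhibits `A` as the quotient of the full subcategory `H` by the ideal of
morphisms factoring through `U`. -/
structure IsIdealQuotient {A : Type u} [Category.{v} A] [Preadditive A] {C : Type u} [Category.{v} C]
    [Preadditive C] (H U : ObjectProperty C) (F : H.FullSubcategory ⥤ A) : Prop where
  full : F.Full
  additive : F.Additive
  surjective : Function.Surjective F.obj
  map_eq_zero_iff : ∀ ⦃X Y : H.FullSubcategory⦄ (f : X ⟶ Y),
    F.map f = 0 ↔ FactorsThroughObj U f.hom

lemma IsIdealQuotient.map_comp_eq_zero {A : Type u} [Category.{v} A] [Preadditive A]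
    {C : Type u} [Category.{v} C] [Preadditive C] {H U : ObjectProperty C} {F : H.FullSubcategory ⥤ A}
    (hF : IsIdealQuotient H U F) {X Y : H.FullSubcategory} {Z : C} (hZ : U Z)
    (i : X.obj ⟶ Z) (p : Z ⟶ Y.obj) :
    F.map (ObjectProperty.homMk (i ≫ p)) = 0 :=
  (hF.map_eq_zero_iff _).2 ⟨Z, hZ, i, p, rfl⟩

variable {C : Type u} [Category.{v} C] [Preadditive C] [HasZeroObject C] [HasShift C ℤ]
  [∀ n : ℤ, (shiftFunctor C n).Additive] [Pretriangulated C]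

namespace IsNestedTorsionPair

variable {R T U V : ObjectProperty C} (h : IsNestedTorsionPair R T U V)
  {A : Type u} [Category.{v} A] [Preadditive A]
  {F : (R.extensionProduct U).FullSubcategory ⥤ A}
  (hF : IsIdealQuotient (R.extensionProduct U) U F)

include h

include hF in
-- Since `Hom(R, U) = 0`, a morphism out of `X` that is zero in the quotient is already zero in `C`,
-- so morphisms descend along `c`. For the epimorphism, the `U`-factorization of `c ≫ g` extends
-- over `K`, and the remaining error factors through `ΣX`, which lies in `U`.
lemma cokernel_of_triangle {X B K : (R.extensionProduct U).FullSubcategory} (hX : R X.obj)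
    {r : X ⟶ B} {c : B ⟶ K} {δ : K.obj ⟶ X.obj⟦(1 : ℤ)⟧}
    (hT : Triangle.mk r.hom c.hom δ ∈ distTriang C) :
    F.map r ≫ F.map c = 0 ∧ Epi (F.map c) ∧
      ∀ ⦃Z : A⦄ (g : F.obj B ⟶ Z), F.map r ≫ g = 0 → ∃ l, F.map c ≫ l = g := by
  have := hF.full
  have := hF.additive
  have hrc : r ≫ c = 0 := ObjectProperty.hom_ext _ (comp_distTriang_mor_zero₁₂ _ hT)
  refine ⟨by rw [← F.map_comp, hrc, F.map_zero], Preadditive.epi_of_cancel_zero _ ?_, ?_⟩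
  · intro Z g hg
    obtain ⟨Z, rfl⟩ := hF.surjective Z
    obtain ⟨g, rfl⟩ := F.map_surjective g
    rw [← F.map_comp] at hg
    obtain ⟨W, hW, i, p, hip⟩ := (hF.map_eq_zero_iff _).1 hg
    obtain ⟨j, rfl⟩ := DistTriang.exists_desc₂ hT i (h.hom_RU hX hW _)
    obtain ⟨q, hq⟩ := DistTriang.exists_desc₃ hT (g.hom - j ≫ p) (by
      rw [Preadditive.comp_sub, ← Category.assoc, hip]
      exact sub_self _)
    have : g = ObjectProperty.homMk (j ≫ p) + ObjectProperty.homMk (δ ≫ q) :=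
      ObjectProperty.hom_ext _ (sub_eq_iff_eq_add'.1 hq.symm)
    rw [this, F.map_add, hF.map_comp_eq_zero hW, hF.map_comp_eq_zero (h.shift_left hX), add_zero]
  · intro Z g hg
    obtain ⟨Z, rfl⟩ := hF.surjective Z
    obtain ⟨g, rfl⟩ := F.map_surjective g
    rw [← F.map_comp] at hg
    obtain ⟨W, hW, i, p, hip⟩ := (hF.map_eq_zero_iff _).1 hg
    obtain ⟨l, hl⟩ := DistTriang.exists_desc₂ hT g.hom (by
      have := h.hom_RU hX hW i
      subst this
      rw [zero_comp] at hip
      exact hip.symm)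
    exact ⟨F.map (ObjectProperty.homMk l), by
      rw [← F.map_comp]; congr 1; exact ObjectProperty.hom_ext _ hl⟩

lemma exists_triangle (B : (R.extensionProduct U).FullSubcategory) :
    ∃ (X : (R.extensionProduct U).FullSubcategory) (Z : C) (s : X ⟶ B) (w : B.obj ⟶ Z)
      (δ : Z ⟶ X.obj⟦(1 : ℤ)⟧),
      Triangle.mk s.hom w δ ∈ distTriang C ∧ R X.obj ∧ U Z := by
  obtain ⟨X, Z, s, w, δ, hT, hX, hZ⟩ := B.property
  exact ⟨⟨X, h.R_le _ hX⟩, Z, ObjectProperty.homMk s, w, δ, hT, hX, hZ⟩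

include hF in
/-- The approximation of an object of `R * U` by an object of `R` becomes an epimorphism in the
quotient. -/
lemma epi_of_triangle {X B : (R.extensionProduct U).FullSubcategory} {Z : C}
    {s : X ⟶ B} {w : B.obj ⟶ Z} {δ : Z ⟶ X.obj⟦(1 : ℤ)⟧}
    (hT : Triangle.mk s.hom w δ ∈ distTriang C) (hX : R X.obj) (hZ : U Z) : Epi (F.map s) := by
  have := hF.additive
  refine Preadditive.epi_of_cancel_zero _ fun g hg => ?_
  -- The cokernel of `F.map s` is `F.map w'`, which is zero because `Z` lies in `U`.
  let Z' : (R.extensionProduct U).FullSubcategory := ⟨Z, h.U_le _ hZ⟩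
  let w' : B ⟶ Z' := ObjectProperty.homMk w
  obtain ⟨l, rfl⟩ := (h.cokernel_of_triangle hF (K := Z') (c := w') hX hT).2.2 g hg
  have : F.map w' = 0 := (hF.map_eq_zero_iff _).2 ⟨Z, hZ, w, 𝟙 Z, Category.comp_id _⟩
  rw [this, zero_comp]

include hF in
/-- Every morphism `F f` in the heart has a cokernel, given by the cone of the restriction of
`f` to an object of `R`. -/
lemma exists_cokernel {X B : (R.extensionProduct U).FullSubcategory} (f : X ⟶ B) :
    ∃ (X' K : (R.extensionProduct U).FullSubcategory) (r : X' ⟶ B) (c : B ⟶ K)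
      (δ : K.obj ⟶ X'.obj⟦(1 : ℤ)⟧), R X'.obj ∧ Triangle.mk r.hom c.hom δ ∈ distTriang C ∧
      F.map f ≫ F.map c = 0 ∧ Epi (F.map c) ∧
      ∀ ⦃Z : A⦄ (g : F.obj B ⟶ Z), F.map f ≫ g = 0 → ∃ l, F.map c ≫ l = g := by
  obtain ⟨X', Z, s, w, ε, hT, hX', hZ⟩ := h.exists_triangle X
  obtain ⟨K, c, δ, hK⟩ := distinguished_cocone_triangle (s ≫ f).hom
  let K' : (R.extensionProduct U).FullSubcategory := ⟨K, h.cone_mem hK hX' B.property⟩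
  obtain ⟨h₁, h₂, h₃⟩ := h.cokernel_of_triangle hF (K := K') (r := s ≫ f)
    (c := ObjectProperty.homMk c) hX' hK
  have := h.epi_of_triangle hF hT hX' hZ
  refine ⟨X', K', s ≫ f, ObjectProperty.homMk c, δ, hX', hK, ?_, h₂, fun Z g hg => h₃ g ?_⟩
  · rw [← cancel_epi (F.map s), ← Category.assoc, ← F.map_comp, h₁, comp_zero]
  · rw [F.map_comp, Category.assoc, hg, comp_zero]

lemma eq_zero_of_mem {M Y : C} (hM : R.extensionProduct U M) (hY : V Y) (m : M ⟶ Y)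
    (hm : ∀ ⦃X : C⦄, R X → ∀ r : X ⟶ M, r ≫ m = 0) : m = 0 := by
  obtain ⟨X, Z, s, w, δ, hT, hX, hZ⟩ := hM
  exact h.eq_zero_of_triangle hT hZ hY m (hm hX s)

/-- The map `d` factors through `Σ⁻¹Y`, which lies in `T`, so it vanishes on the `R`-part of `M` and
passes to the `U`-part. -/
lemma factors_of_comp_eq_zero {M K N Y : C} (hM : R.extensionProduct U M)
    {j : K ⟶ N} {m : N ⟶ Y} {δ : Y ⟶ K⟦(1 : ℤ)⟧} (hT : Triangle.mk j m δ ∈ distTriang C)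
    (hY : V Y) (d : M ⟶ K) (hd : d ≫ j = 0) : FactorsThroughObj U d := by
  obtain ⟨e, rfl⟩ := Triangle.coyoneda_exact₂ _ (inv_rot_of_distTriang _ hT) d hd
  obtain ⟨X, Z, s, w, ε, hM, hX, hZ⟩ := hM
  obtain ⟨e', rfl⟩ := Triangle.yoneda_exact₂ _ hM e
    (h.left.hom_eq_zero hX (h.shift_right hY) _)
  exact ⟨Z, hZ, w, _, (Category.assoc _ _ _).symm⟩

lemma exists_lift {Z K N Y : C} (hZ : U Z)
    {j : K ⟶ N} {m : N ⟶ Y} {δ : Y ⟶ K⟦(1 : ℤ)⟧} (hT : Triangle.mk j m δ ∈ distTriang C)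
    (hY : V Y) (p : Z ⟶ N) : ∃ l, l ≫ j = p :=
  DistTriang.exists_lift₁ hT p (h.hom_UV hZ hY _)

lemma comp_shift_eq_zero {Z K N Y : C} (hZ : U Z)
    {j : K ⟶ N} {m : N ⟶ Y} {δ : Y ⟶ K⟦(1 : ℤ)⟧} (hT : Triangle.mk j m δ ∈ distTriang C)
    (hY : V Y) (p : Z ⟶ K⟦(1 : ℤ)⟧) (hp : p ≫ j⟦(1 : ℤ)⟧' = 0) : p = 0 := by
  obtain ⟨q, rfl⟩ := DistTriang.exists_lift₃ hT p hp
  have := h.hom_UV hZ hY q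
  subst this
  exact zero_comp

include hF in
/-- Every morphism `F f` in the heart has a kernel `F k`, such that moreover the shift of `k` is
a monomorphism with respect to morphisms from objects of `U`. -/
lemma exists_kernel [IsTriangulated C] {X B : (R.extensionProduct U).FullSubcategory}
    (f : X ⟶ B) :
    ∃ (K : (R.extensionProduct U).FullSubcategory) (k : K ⟶ X),
      F.map k ≫ F.map f = 0 ∧ Mono (F.map k) ∧
      (∀ ⦃Z : A⦄ (g : Z ⟶ F.obj X), g ≫ F.map f = 0 → ∃ l, l ≫ F.map k = g) ∧
      ∀ ⦃Z : C⦄, U Z → ∀ p : Z ⟶ K.obj⟦(1 : ℤ)⟧, p ≫ k.hom⟦(1 : ℤ)⟧' = 0 → p = 0 := by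
  have := hF.full
  have := hF.additive
  -- On the fibre `K₀` of `X ⟶ B ⟶ VB` the morphism `f` factors through `UB`; then `K₀` is replaced
  -- by an object of `R * U`.
  obtain ⟨UB, VB, a, b, β, hB, hUB, hVB⟩ := h.right.exists_triangle B.obj
  obtain ⟨K₀, k₀, η, hK₀⟩ := distinguished_cocone_triangle₁ (f.hom ≫ b)
  obtain ⟨K, Y, j, m, δ, hK, hKm, hY, hm⟩ := h.exists_approximation K₀
  have hk₀ : k₀ ≫ f.hom ≫ b = 0 := comp_distTriang_mor_zero₁₂ _ hK₀
  let K' : (R.extensionProduct U).FullSubcategory := ⟨K, hKm⟩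
  refine ⟨K', ObjectProperty.homMk (j ≫ k₀), ?_, Preadditive.mono_of_cancel_zero _ ?_, ?_, ?_⟩
  · obtain ⟨i, hi⟩ := DistTriang.exists_lift₁ hB (j ≫ k₀ ≫ f.hom) (by
      rw [Category.assoc, Category.assoc, hk₀, comp_zero])
    rw [← F.map_comp]
    exact (hF.map_eq_zero_iff _).2 ⟨UB, hUB, i, a, hi.trans (Category.assoc _ _ _).symm⟩
  · intro Z g hg
    obtain ⟨Z, rfl⟩ := hF.surjective Z
    obtain ⟨g, rfl⟩ := F.map_surjective g
    rw [← F.map_comp] at hg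
    obtain ⟨W, hW, i, p, hip⟩ := (hF.map_eq_zero_iff _).1 hg
    change i ≫ p = g.hom ≫ j ≫ k₀ at hip
    -- Maps from `U` lift along `k₀` and `j`, whose cones lie in `V`. Subtracting the lifts leaves
    -- maps killed by `k₀`, then by `j`, each of which factors through `U`.
    obtain ⟨p₀, rfl⟩ := h.exists_lift hW hK₀ hVB p
    obtain ⟨p₁, rfl⟩ := h.exists_lift hW hK hY p₀
    obtain ⟨W', hW', i', p', hip'⟩ := h.factors_of_comp_eq_zero Z.property hK₀ hVB
      ((g.hom - i ≫ p₁) ≫ j) (by simp [← hip])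
    obtain ⟨p'₁, rfl⟩ := h.exists_lift hW' hK hY p'
    obtain ⟨W'', hW'', i'', p'', hip''⟩ := h.factors_of_comp_eq_zero Z.property hK hY
      (g.hom - i ≫ p₁ - i' ≫ p'₁) (by rw [Preadditive.sub_comp _ _ j, ← hip']; simp)
    have : g = ObjectProperty.homMk (i'' ≫ p'') + ObjectProperty.homMk (i' ≫ p'₁) +
        ObjectProperty.homMk (i ≫ p₁) := by
      refine ObjectProperty.hom_ext _ ?_
      change g.hom = i'' ≫ p'' + i' ≫ p'₁ + i ≫ p₁
      rw [hip'']
      abel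
    rw [this, F.map_add, F.map_add, hF.map_comp_eq_zero hW, hF.map_comp_eq_zero hW',
      hF.map_comp_eq_zero hW'', add_zero, add_zero]
  · intro Z g hg
    obtain ⟨Z, rfl⟩ := hF.surjective Z
    obtain ⟨g, rfl⟩ := F.map_surjective g
    rw [← F.map_comp] at hg
    obtain ⟨W, hW, i, p, hip⟩ := (hF.map_eq_zero_iff _).1 hg
    change i ≫ p = g.hom ≫ f.hom at hip
    obtain ⟨g₁, hg₁⟩ := DistTriang.exists_lift₁ hK₀ g.hom (by
      rw [← Category.assoc, ← hip, Category.assoc, h.hom_UV hW hVB (p ≫ b), comp_zero])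
    obtain ⟨g₂, rfl⟩ := DistTriang.exists_lift₁ hK g₁ (by
      refine h.eq_zero_of_mem Z.property hY _ fun X hX r => ?_
      exact (Category.assoc _ _ _).symm.trans (hm hX (r ≫ g₁)))
    refine ⟨F.map (ObjectProperty.homMk g₂), ?_⟩
    rw [← F.map_comp]
    congr 1
    exact ObjectProperty.hom_ext _ ((Category.assoc _ _ _).symm.trans hg₁)
  · intro Z hZ p hp
    refine h.comp_shift_eq_zero hZ hK hY p (h.comp_shift_eq_zero hZ hK₀ hVB _ ?_)
    simpa using hp

end IsNestedTorsionPair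

end IdealQuotient

/-! ### Stability of cokernels and kernels in the quotient. -/

section QuasiAbelianQuotient

variable {C : Type u} [Category.{v} C] [Preadditive C] [HasZeroObject C] [HasShift C ℤ]
  [∀ n : ℤ, (shiftFunctor C n).Additive] [Pretriangulated C]
  {R T U V : ObjectProperty C} {A : Type u} [Category.{v} A] [Preadditive A]
  {F : (R.extensionProduct U).FullSubcategory ⥤ A}

namespace IsNestedTorsionPair

variable (h : IsNestedTorsionPair R T U V) (hF : IsIdealQuotient (R.extensionProduct U) U F)

include h hF

lemma hasFiniteBiproducts : HasFiniteBiproducts A := by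
  have := hF.additive
  have hz : HasZeroObject A := by
    let Z : (R.extensionProduct U).FullSubcategory :=
      ⟨0, h.U_le _ (h.right.left_of_isZero (isZero_zero C))⟩
    refine ⟨F.obj Z, (IsZero.iff_id_eq_zero _).2 ?_⟩
    rw [← F.map_id]
    exact (hF.map_eq_zero_iff _).2
      ⟨0, h.right.left_of_isZero (isZero_zero C), 𝟙 _, 𝟙 _, Category.comp_id _⟩
  have hb : HasBinaryBiproducts A := ⟨fun X Y => by
    obtain ⟨X, rfl⟩ := hF.surjective X
    obtain ⟨Y, rfl⟩ := hF.surjective Y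
    let B : (R.extensionProduct U).FullSubcategory :=
      ⟨X.obj ⊞ Y.obj, h.biprod_mem X.property Y.property⟩
    let inl : X ⟶ B := ObjectProperty.homMk biprod.inl
    let inr : Y ⟶ B := ObjectProperty.homMk biprod.inr
    let fst : B ⟶ X := ObjectProperty.homMk biprod.fst
    let snd : B ⟶ Y := ObjectProperty.homMk biprod.snd
    have h₁ : inl ≫ fst = 𝟙 X := ObjectProperty.hom_ext _ biprod.inl_fst
    have h₂ : inl ≫ snd = 0 := ObjectProperty.hom_ext _ biprod.inl_snd
    have h₃ : inr ≫ fst = 0 := ObjectProperty.hom_ext _ biprod.inr_fst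
    have h₄ : inr ≫ snd = 𝟙 Y := ObjectProperty.hom_ext _ biprod.inr_snd
    have h₅ : fst ≫ inl + snd ≫ inr = 𝟙 B := ObjectProperty.hom_ext _ biprod.total
    exact hasBinaryBiproduct_of_total
      { pt := F.obj B
        inl := F.map inl
        inr := F.map inr
        fst := F.map fst
        snd := F.map snd
        inl_fst := by rw [← F.map_comp, h₁, F.map_id]
        inl_snd := by rw [← F.map_comp, h₂, F.map_zero]
        inr_fst := by rw [← F.map_comp, h₃, F.map_zero]
        inr_snd := by rw [← F.map_comp, h₄, F.map_id] }
      (by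
        change F.map fst ≫ F.map inl + F.map snd ≫ F.map inr = 𝟙 _
        rw [← F.map_comp, ← F.map_comp, ← F.map_add, h₅, F.map_id])⟩
  have : HasFiniteProducts A := hasFiniteProducts_of_has_binary_and_terminal
  exact HasFiniteBiproducts.of_hasFiniteProducts

lemma hasCokernels : HasCokernels A := ⟨fun {X B} f => by
  have := hF.full
  obtain ⟨X, rfl⟩ := hF.surjective X
  obtain ⟨B, rfl⟩ := hF.surjective B
  obtain ⟨f, rfl⟩ := F.map_surjective f
  obtain ⟨X', K, r, c, δ, -, -, h₁, h₂, h₃⟩ := h.exists_cokernel hF f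
  exact ⟨_, CokernelCofork.IsColimit.ofπ (F.map c) h₁ (fun k hk => (h₃ k hk).choose)
    (fun k hk => (h₃ k hk).choose_spec)
    (fun k hk m hm => by rw [← cancel_epi (F.map c), hm, (h₃ k hk).choose_spec])⟩⟩

lemma hasKernels [IsTriangulated C] : HasKernels A := ⟨fun {X B} f => by
  have := hF.full
  obtain ⟨X, rfl⟩ := hF.surjective X
  obtain ⟨B, rfl⟩ := hF.surjective B
  obtain ⟨f, rfl⟩ := F.map_surjective f
  obtain ⟨K, k, h₁, h₂, h₃, -⟩ := h.exists_kernel hF f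
  exact ⟨_, KernelFork.IsLimit.ofι (F.map k) h₁ (fun g hg => (h₃ g hg).choose)
    (fun g hg => (h₃ g hg).choose_spec)
    (fun g hg m hm => by rw [← cancel_mono (F.map k), hm, (h₃ g hg).choose_spec])⟩⟩

/-- The image in the quotient of the cone of a morphism from an object of `R` is a cokernel, and so
are its pullbacks. -/
lemma cokernelMorphisms_of_isPullback_map [IsTriangulated C]
    {X B K Y P : (R.extensionProduct U).FullSubcategory} (hX : R X.obj)
    {r : X ⟶ B} {c : B ⟶ K} {δ : K.obj ⟶ X.obj⟦(1 : ℤ)⟧}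
    (hT : Triangle.mk r.hom c.hom δ ∈ distTriang C) {y : Y ⟶ K} {p : P ⟶ B} {q : P ⟶ Y}
    (sq : IsPullback (F.map p) (F.map q) (F.map c) (F.map y)) :
    cokernelMorphisms A (F.map q) := by
  have := hF.full
  have := hF.additive
  -- Adding the `U`-approximation `W` of `K` to `Y` changes nothing in the quotient, but lets
  -- squares commuting modulo `U` be made commutative in `C`. Then `Z` is a homotopy pullback of `c`
  -- along `(y, a)`.
  obtain ⟨W, K', a, b, ε, hK, hW, hK'⟩ := h.right.exists_triangle K.obj
  have hY' := h.biprod_mem Y.property (h.U_le _ hW)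
  obtain ⟨Z, s, t, hZ⟩ := distinguished_cocone_triangle₂ (biprod.desc y.hom a ≫ δ)
  obtain ⟨β, hβ₁, hβ₂⟩ := DistTriang.exists_hom₂ hZ hT (biprod.desc y.hom a) rfl
  let Y' : (R.extensionProduct U).FullSubcategory := ⟨Y.obj ⊞ W, hY'⟩
  let Z' : (R.extensionProduct U).FullSubcategory := ⟨Z, h.extension_mem hZ hX hY'⟩
  let s' : X ⟶ Z' := ObjectProperty.homMk s
  let t' : Z' ⟶ Y' := ObjectProperty.homMk t
  let β' : Z' ⟶ B := ObjectProperty.homMk β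
  let fst : Y' ⟶ Y := ObjectProperty.homMk biprod.fst
  let inl : Y ⟶ Y' := ObjectProperty.homMk biprod.inl
  have hfst : F.map fst ≫ F.map inl = 𝟙 _ := by
    have : 𝟙 Y' = fst ≫ inl + ObjectProperty.homMk (biprod.snd ≫ biprod.inr) :=
      ObjectProperty.hom_ext _ biprod.total.symm
    rw [← F.map_id, this, F.map_add, hF.map_comp_eq_zero hW, add_zero, F.map_comp]
  have hinl : F.map inl ≫ F.map fst = 𝟙 _ := by
    rw [← F.map_comp, ← F.map_id]
    congr 1
    exact ObjectProperty.hom_ext _ biprod.inl_fst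
  have hw : F.map β' ≫ F.map c = F.map (t' ≫ fst) ≫ F.map y := by
    rw [← F.map_comp, ← F.map_comp, ← sub_eq_zero, ← F.map_sub]
    refine (hF.map_eq_zero_iff _).2 ⟨W, hW, t ≫ biprod.snd, a, ?_⟩
    change _ = β ≫ c.hom - (t ≫ biprod.fst) ≫ y.hom
    rw [← hβ₂, biprod.desc_eq]
    simp
  obtain ⟨h₁, h₂, h₃⟩ := h.cokernel_of_triangle hF (r := s') (c := t') hX hZ
  obtain ⟨N, hN, i, n, hin⟩ : FactorsThroughObj U (p ≫ c - q ≫ y).hom := by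
    rw [← hF.map_eq_zero_iff, F.map_sub, F.map_comp, F.map_comp, sq.w, sub_self]
  change i ≫ n = p.hom ≫ c.hom - q.hom ≫ y.hom at hin
  obtain ⟨n', rfl⟩ := h.exists_lift hN hK hK' n
  have hd : biprod.lift q.hom (i ≫ n') ≫ biprod.desc y.hom a = p.hom ≫ c.hom := by
    simp [hin]
  obtain ⟨l, hl⟩ := DistTriang.exists_lift₂ hZ (biprod.lift q.hom (i ≫ n')) (by
    rw [reassoc_of% hd, DistTriang.comp₂₃ hT, comp_zero])
  obtain ⟨m, hm⟩ := DistTriang.exists_lift₁ hT (l ≫ β - p.hom) (by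
    rw [Preadditive.sub_comp, Category.assoc, ← hβ₂, reassoc_of% hl, hd, sub_self])
  -- Correcting `l` by a map through `X` makes its `B`-component exactly `p`. So `F.map σ` is a
  -- section of the comparison `τ`, and `q` is a cokernel because `τ ≫ F.map q` is.
  let σ : P ⟶ Z' := ObjectProperty.homMk (l - m ≫ s)
  have hσ₁ : σ ≫ β' = p := ObjectProperty.hom_ext _ (by
    change (l - m ≫ s) ≫ β = p.hom
    rw [Preadditive.sub_comp, Category.assoc, hβ₁, hm]
    abel)
  have hσ₂ : σ ≫ t' ≫ fst = q := ObjectProperty.hom_ext _ (by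
    change (l - m ≫ s) ≫ t ≫ biprod.fst = q.hom
    rw [← Category.assoc, Preadditive.sub_comp, Category.assoc, DistTriang.comp₁₂ hZ, hl]
    simp)
  let τ : F.obj Z' ⟶ F.obj P := sq.lift (F.map β') (F.map (t' ≫ fst)) hw
  have hτ : F.map σ ≫ τ = 𝟙 _ := by
    apply sq.hom_ext
    · rw [Category.assoc, sq.lift_fst, ← F.map_comp, hσ₁, Category.id_comp]
    · rw [Category.assoc, sq.lift_snd, ← F.map_comp, hσ₂, Category.id_comp]
  have : IsSplitEpi τ := ⟨⟨⟨F.map σ, hτ⟩⟩⟩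
  refine cokernelMorphisms_of_epi_comp τ _ ?_
  rw [sq.lift_snd, F.map_comp]
  have : IsIso (F.map fst) := ⟨F.map inl, hfst, hinl⟩
  refine (cokernelMorphisms_iff _).2 ⟨inferInstance, F.obj X, F.map s', ?_, fun Q k hk => ?_⟩
  · rw [← Category.assoc, h₁, zero_comp]
  · obtain ⟨l', hl'⟩ := h₃ k hk
    exact ⟨F.map inl ≫ l', by rw [Category.assoc, reassoc_of% hfst, hl']⟩

/-- Any cokernel `c` becomes the image of a cone map after composing with a monomorphism `e`, and
composing both legs of a cospan with `e` does not change its pullback. -/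
lemma cokernelMorphisms_isStableUnderBaseChange [IsTriangulated C] :
    (cokernelMorphisms A).IsStableUnderBaseChange := ⟨fun {Y B P K} y c p q sq hc => by
  have := hF.full
  obtain ⟨_, W, f, hfc, hd⟩ := (cokernelMorphisms_iff _).1 hc
  obtain ⟨W, rfl⟩ := hF.surjective W
  obtain ⟨B, rfl⟩ := hF.surjective B
  obtain ⟨Y, rfl⟩ := hF.surjective Y
  obtain ⟨P, rfl⟩ := hF.surjective P
  obtain ⟨f, rfl⟩ := F.map_surjective f
  obtain ⟨p, rfl⟩ := F.map_surjective p
  obtain ⟨q, rfl⟩ := F.map_surjective q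
  obtain ⟨X, K', r, c', δ, hX, hT, h₁, h₂, h₃⟩ := h.exists_cokernel hF f
  obtain ⟨e, he⟩ := hd _ h₁
  obtain ⟨e', he'⟩ := h₃ _ hfc
  have hee' : e ≫ e' = 𝟙 _ := by rw [← cancel_epi c, reassoc_of% he, he', Category.comp_id]
  obtain ⟨y', hy'⟩ := F.map_surjective (y ≫ e)
  have : IsSplitMono e := ⟨⟨⟨e', hee'⟩⟩⟩
  refine h.cokernelMorphisms_of_isPullback_map hF hX hT (y := y') (p := p) ?_
  rw [hy', ← he]
  exact ⟨⟨by rw [reassoc_of% sq.w]⟩, ⟨PullbackCone.IsLimit.mk _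
    (fun s => sq.lift s.fst s.snd (by
      rw [← cancel_mono e, Category.assoc, Category.assoc, s.condition]))
    (fun s => sq.lift_fst _ _ _) (fun s => sq.lift_snd _ _ _)
    (fun s m h₁ h₂ => sq.hom_ext (by rw [h₁, sq.lift_fst]) (by rw [h₂, sq.lift_snd]))⟩⟩⟩

/-- The pushout is compared with the cone `Q` of `S ⟶ K' ⟶ B ⊞ X`, where `S` is the `R`-part of
`K'`. As `X ⟶ Q` factors through `x`, it suffices that the former is mono. -/
lemma mono_of_isPushout [IsTriangulated C] {K B X P : A} {k : K ⟶ B} {g : K ⟶ X} {a : B ⟶ P}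
    {x : X ⟶ P} (sq : IsPushout k g a x) (hk : kernelMorphisms A k) : Mono x := by
  have := hF.full
  have := hF.additive
  obtain ⟨⟨W, f, hkf, hl⟩⟩ := hk
  obtain ⟨W, rfl⟩ := hF.surjective W
  obtain ⟨B, rfl⟩ := hF.surjective B
  obtain ⟨X, rfl⟩ := hF.surjective X
  obtain ⟨f, rfl⟩ := F.map_surjective f
  obtain ⟨K', k', h₁, h₂, h₃, h₄⟩ := h.exists_kernel hF f
  obtain ⟨e, he⟩ : ∃ e : F.obj K' ⟶ K, e ≫ k = F.map k' :=
    ⟨_, (KernelFork.IsLimit.lift' hl _ h₁).2⟩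
  obtain ⟨e', he'⟩ := h₃ k hkf
  have : Mono k := ⟨fun a b hab => Fork.IsLimit.hom_ext hl hab⟩
  have hee' : e' ≫ e = 𝟙 _ := by rw [← cancel_mono k, Category.assoc, he, he', Category.id_comp]
  have : IsSplitEpi e := ⟨⟨⟨e', hee'⟩⟩⟩
  obtain ⟨g', hg'⟩ := F.map_surjective (e ≫ g)
  obtain ⟨S, N, s, w, ε, hT, hS, hN⟩ := h.exists_triangle K'
  obtain ⟨Q, c, δ, hQ⟩ := distinguished_cocone_triangle (s.hom ≫ biprod.lift k'.hom (-g'.hom))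
  let BX : (R.extensionProduct U).FullSubcategory :=
    ⟨B.obj ⊞ X.obj, h.biprod_mem B.property X.property⟩
  let Q' : (R.extensionProduct U).FullSubcategory := ⟨Q, h.cone_mem hQ hS BX.property⟩
  obtain ⟨l, hl₁, hl₂⟩ := DistTriang.exists_hom₃ hT hQ (biprod.lift k'.hom (-g'.hom)) rfl
  let a' : B ⟶ Q' := ObjectProperty.homMk (biprod.inl ≫ c)
  let x' : X ⟶ Q' := ObjectProperty.homMk (biprod.inr ≫ c)
  have hw : k ≫ F.map a' = g ≫ F.map x' := by
    rw [← cancel_epi e, reassoc_of% he]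
    rw [← Category.assoc, ← hg', ← F.map_comp, ← F.map_comp, ← sub_eq_zero, ← F.map_sub]
    refine (hF.map_eq_zero_iff _).2 ⟨N, hN, w, l, ?_⟩
    change _ = k'.hom ≫ biprod.inl ≫ c - g'.hom ≫ biprod.inr ≫ c
    rw [hl₁, biprod.lift_eq]
    simp [sub_eq_add_neg]
  have hx' : x ≫ sq.desc (F.map a') (F.map x') hw = F.map x' := sq.inr_desc _ _ _
  suffices Mono (F.map x') from mono_of_mono_fac hx'
  refine Preadditive.mono_of_cancel_zero _ fun {Z} z hz => ?_
  obtain ⟨Z, rfl⟩ := hF.surjective Z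
  obtain ⟨z, rfl⟩ := F.map_surjective z
  rw [← F.map_comp] at hz
  obtain ⟨N', hN', i, p, hip⟩ := (hF.map_eq_zero_iff _).1 hz
  change i ≫ p = z.hom ≫ biprod.inr ≫ c at hip
  -- The extra property of the kernel `k'` enters here: this map from `U` to `ΣK'` is killed by
  -- `Σk'`.
  have hpδ : p ≫ δ ≫ s.hom⟦(1 : ℤ)⟧' = 0 := by
    refine h₄ hN' _ ?_
    have := p ≫= DistTriang.comp₃₁ hQ =≫ (biprod.fst : B.obj ⊞ X.obj ⟶ B.obj)⟦(1 : ℤ)⟧'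
    simpa [← Functor.map_comp] using this
  obtain ⟨q, hq⟩ := DistTriang.exists_lift₃ hT (p ≫ δ) (by rw [Category.assoc, hpδ])
  obtain ⟨n, hn⟩ := DistTriang.exists_lift₂ hQ (p - q ≫ l) (by
    rw [Preadditive.sub_comp, Category.assoc, hl₂, hq, sub_self])
  have hd : (z.hom ≫ biprod.inr - i ≫ n) ≫ c = i ≫ q ≫ l := by
    rw [Preadditive.sub_comp, Category.assoc, Category.assoc, hn, ← hip]
    simp
  obtain ⟨t, ht⟩ := DistTriang.exists_lift₂ hT (i ≫ q) (by
    rw [Category.assoc, hq, reassoc_of% hip, DistTriang.comp₂₃ hQ, comp_zero, comp_zero])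
  obtain ⟨m, hm⟩ := DistTriang.exists_lift₁ hQ
    (z.hom ≫ biprod.inr - i ≫ n - t ≫ biprod.lift k'.hom (-g'.hom)) (by
      rw [Preadditive.sub_comp, hd, Category.assoc, ← hl₁, reassoc_of% ht, sub_self])
  -- Modulo `U`, `(0, z)` is now `t'` followed by `(k', -g')`. The `B`-component gives `F.map t' =
  -- 0` as `F.map k'` is mono; the `X`-component then gives `F.map z = 0`.
  let t' : Z ⟶ K' := ObjectProperty.homMk (t + m ≫ s.hom)
  have ht' : t'.hom ≫ biprod.lift k'.hom (-g'.hom) = z.hom ≫ biprod.inr - i ≫ n := by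
    change (t + m ≫ s.hom) ≫ _ = _
    rw [Preadditive.add_comp, Category.assoc, hm]
    abel
  have hft : F.map t' = 0 := by
    rw [← cancel_mono (F.map k'), zero_comp, ← F.map_comp]
    refine (hF.map_eq_zero_iff _).2 ⟨N', hN', -i, n ≫ biprod.fst, ?_⟩
    simpa using (ht' =≫ biprod.fst).symm
  have hzt : z = ObjectProperty.homMk (i ≫ n ≫ biprod.snd) - t' ≫ g' := by
    refine ObjectProperty.hom_ext _ ?_
    change z.hom = i ≫ n ≫ biprod.snd - t'.hom ≫ g'.hom
    have := ht' =≫ biprod.snd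
    simp only [Category.assoc, biprod.lift_snd, Preadditive.comp_neg, Preadditive.sub_comp,
      biprod.inr_snd, Category.comp_id] at this
    rw [sub_eq_add_neg, this]
    abel
  rw [hzt, F.map_sub, F.map_comp, hft, zero_comp, hF.map_comp_eq_zero hN', sub_zero]

lemma isQuasiAbelian [IsTriangulated C] : IsQuasiAbelian A := by
  have := h.hasFiniteBiproducts hF
  have := HasBinaryBiproducts.of_hasBinaryProducts (C := A)
  have := h.hasKernels hF
  have := h.hasCokernels hF
  have := h.cokernelMorphisms_isStableUnderBaseChange hF
  exact
    { hasFiniteBiproducts := inferInstance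
      hasKernels := inferInstance
      hasCokernels := inferInstance
      cokernels_stable := inferInstance
      kernels_stable := kernelMorphisms_isStableUnderCobaseChange
        fun _ _ _ _ _ _ _ _ sq hk => h.mono_of_isPushout hF sq hk }

end IsNestedTorsionPair

end QuasiAbelianQuotient

/-! ### Passage to the opposite category. -/

section Opposite

open Opposite CategoryTheory.Pretriangulated.Opposite

lemma FactorsThroughObj.op {C : Type u} [Category.{v} C] {W : ObjectProperty C} {X Y : C}
    {f : X ⟶ Y} (h : FactorsThroughObj W f) : FactorsThroughObj W.op f.op := by
  obtain ⟨Z, hZ, i, p, rfl⟩ := h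
  exact ⟨Opposite.op Z, hZ, p.op, i.op, rfl⟩

lemma FactorsThroughObj.unop {C : Type u} [Category.{v} C] {W : ObjectProperty C} {X Y : Cᵒᵖ}
    {f : X ⟶ Y} (h : FactorsThroughObj W.op f) : FactorsThroughObj W f.unop := by
  obtain ⟨Z, hZ, i, p, rfl⟩ := h
  exact ⟨Z.unop, hZ, p.unop, i.unop, rfl⟩

/-- The comparison functor from the full subcategory of `Cᵒᵖ` to the opposite of the full
subcategory of `C`. -/
def CategoryTheory.ObjectProperty.opFullSubcategoryFunctor {C : Type u} [Category.{v} C]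
    (H : ObjectProperty C) : H.op.FullSubcategory ⥤ H.FullSubcategoryᵒᵖ where
  obj X := Opposite.op ⟨X.obj.unop, X.property⟩
  map f := Quiver.Hom.op (ObjectProperty.homMk f.hom.unop)

lemma IsIdealQuotient.op {C : Type u} [Category.{v} C] [Preadditive C] {A : Type u}
    [Category.{v} A] [Preadditive A] {H U : ObjectProperty C} {F : H.FullSubcategory ⥤ A}
    (hF : IsIdealQuotient H U F) :
    IsIdealQuotient H.op U.op (H.opFullSubcategoryFunctor ⋙ F.op) where
  full := by
    have := hF.full
    refine ⟨fun {X Y} f => ?_⟩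
    obtain ⟨g, hg⟩ := F.map_surjective f.unop
    exact ⟨ObjectProperty.homMk g.hom.op, Quiver.Hom.unop_inj hg⟩
  additive := by
    have := hF.additive
    exact ⟨fun {X Y f g} => Quiver.Hom.unop_inj (F.map_add (X := ⟨Y.obj.unop, Y.property⟩)
      (Y := ⟨X.obj.unop, X.property⟩) (f := ObjectProperty.homMk f.hom.unop)
      (g := ObjectProperty.homMk g.hom.unop))⟩
  surjective X := by
    obtain ⟨Y, hY⟩ := hF.surjective X.unop
    exact ⟨⟨Opposite.op Y.obj, Y.property⟩, congrArg Opposite.op hY⟩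
  map_eq_zero_iff X Y f := by
    have := hF.map_eq_zero_iff (ObjectProperty.homMk (P := H) (X := ⟨Y.obj.unop, Y.property⟩)
      (Y := ⟨X.obj.unop, X.property⟩) f.hom.unop)
    constructor
    · intro h
      exact (this.1 (Quiver.Hom.op_inj h)).op
    · intro h
      exact Quiver.Hom.unop_inj (this.2 h.unop)

variable {C : Type u} [Category.{v} C] [Preadditive C] [HasZeroObject C] [HasShift C ℤ]
  [∀ n : ℤ, (shiftFunctor C n).Additive] [Pretriangulated C]

lemma CategoryTheory.ObjectProperty.op_extensionProduct (P Q : ObjectProperty C) :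
    (P.extensionProduct Q).op = Q.op.extensionProduct P.op := by
  ext X
  constructor
  · rintro ⟨Y, Z, f, g, δ, hT, hY, hZ⟩
    exact ⟨_, _, _, _, _, op_distinguished _ hT, hZ, hY⟩
  · rintro ⟨Y, Z, f, g, δ, hT, hY, hZ⟩
    exact ⟨_, _, _, _, _, unop_distinguished _ hT, hZ, hY⟩

lemma IsWeakTorsionPair.op {P Q : ObjectProperty C} (h : IsWeakTorsionPair P Q) :
    IsWeakTorsionPair Q.op P.op where
  left_retracts := by
    have := h.right_retracts
    exact ⟨fun r hY => Q.prop_of_retract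
      ⟨r.r.unop, r.i.unop, Quiver.Hom.op_inj r.retract⟩ hY⟩
  right_retracts := by
    have := h.left_retracts
    exact ⟨fun r hY => P.prop_of_retract
      ⟨r.r.unop, r.i.unop, Quiver.Hom.op_inj r.retract⟩ hY⟩
  hom_eq_zero X Y hX hY f := Quiver.Hom.unop_inj (h.hom_eq_zero hY hX f.unop)
  extensionProduct_eq_top := by
    rw [← ObjectProperty.op_extensionProduct, h.extensionProduct_eq_top]
    rfl

end Opposite

/-! ### From twin cotorsion pairs to nested torsion pairs. -/

section TwinCotorsion

lemma CategoryTheory.ObjectProperty.shift_isStableUnderRetracts {C : Type u} [Category.{v} C]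
    [HasShift C ℤ] (P : ObjectProperty C)
    [P.IsStableUnderRetracts] (n : ℤ) : (P.shift n).IsStableUnderRetracts :=
  ⟨fun r hY => P.prop_of_retract (r.map (shiftFunctor C n)) hY⟩

lemma eq_zero_of_comp_shiftNegShift_inv {C : Type u} [Category.{v} C] [Preadditive C]
    [HasShift C ℤ] {X Y : C} (f : X ⟶ Y)
    (hf : f ≫ (shiftNegShift Y (1 : ℤ)).inv = 0) : f = 0 := by
  rwa [← cancel_mono (shiftNegShift Y (1 : ℤ)).inv, zero_comp]

variable {C : Type u} [Category.{v} C] [Preadditive C] [HasZeroObject C] [HasShift C ℤ]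
  [∀ n : ℤ, (shiftFunctor C n).Additive] [Pretriangulated C]

namespace IsCotorsionPair

variable {U V : ObjectProperty C} (h : IsCotorsionPair U V)

include h

lemma isWeakTorsionPair_shift_left : IsWeakTorsionPair (U.shift (1 : ℤ)) V := by
  have := h.left_additive.closedUnderSummands
  have := h.right_additive.closedUnderSummands
  refine ⟨U.shift_isStableUnderRetracts 1, inferInstance, fun X Y hX hY f => ?_, ?_⟩
  · apply (shiftFunctor C (1 : ℤ)).map_injective
    rw [Functor.map_zero]
    exact h.ext_one_eq_zero hX hY _
  · refine eq_top_iff.2 fun X _ => ?_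
    have hX : U.extensionProduct (V.shift (-1 : ℤ)) (X⟦(1 : ℤ)⟧) := by
      simp [h.extensionProduct_eq_top]
    have := V.shift_isStableUnderRetracts (-1)
    have := ObjectProperty.extensionProduct_of_shift 1 hX
    rwa [ObjectProperty.shift_shift _ (1 : ℤ) (-1) 0 (by simp), ObjectProperty.shift_zero] at this

lemma isWeakTorsionPair_shift_right : IsWeakTorsionPair U (V.shift (-1 : ℤ)) := by
  have := h.left_additive.closedUnderSummands
  have := h.right_additive.closedUnderSummands
  exact ⟨inferInstance, V.shift_isStableUnderRetracts (-1), fun X Y hX hY f =>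
    eq_zero_of_comp_shiftNegShift_inv f (h.ext_one_eq_zero hX hY _), h.extensionProduct_eq_top⟩

end IsCotorsionPair

namespace TwinCotorsionPair

variable (P : TwinCotorsionPair C)

lemma isNestedTorsionPair_of_le (h : P.U ≤ P.T) :
    IsNestedTorsionPair (P.S.shift (1 : ℤ)) P.T P.U (P.V.shift (-1 : ℤ)) where
  left := P.isCotorsionPair_left.isWeakTorsionPair_shift_left
  right := P.isCotorsionPair_right.isWeakTorsionPair_shift_right
  le := h
  hom_shift_eq_zero _ _ hX hY f :=
    eq_zero_of_comp_shiftNegShift_inv f (P.ext_one_eq_zero hX hY _)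

open CategoryTheory.Pretriangulated.Opposite in
-- Duality exchanges `Σ⁻¹S` with `ΣV` and `T` with `U`. Suspension in `Cᵒᵖ` is `Σ⁻¹`, so the last
-- condition is again `Ext¹(S, V) = 0`.
lemma isNestedTorsionPair_op_of_le (h : P.T ≤ P.U) :
    IsNestedTorsionPair (P.V.shift (-1 : ℤ)).op P.U.op P.T.op (P.S.shift (1 : ℤ)).op where
  left := P.isCotorsionPair_right.isWeakTorsionPair_shift_right.op
  right := P.isCotorsionPair_left.isWeakTorsionPair_shift_left.op
  le X hX := h _ hX
  hom_shift_eq_zero X Y hX hY f := by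
    apply Quiver.Hom.unop_inj
    apply (shiftFunctor C (1 : ℤ)).map_injective
    exact (P.ext_one_eq_zero hY hX (f.unop⟦(1 : ℤ)⟧')).trans (Functor.map_zero _ _ _).symm

lemma isIdealQuotient_heart :
    IsIdealQuotient P.H P.W (CategoryTheory.Quotient.functor (idealRel P.H P.W)) where
  full := inferInstance
  additive := CategoryTheory.Quotient.functor_additive _ (idealRel_add P.H)
  surjective X := ⟨X.as, rfl⟩
  map_eq_zero_iff X Y f := by
    have := CategoryTheory.Quotient.functor_map_eq_iff (idealRel P.H P.W) f 0
    refine this.trans ?_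
    change FactorsThroughObj P.W (f.hom - 0) ↔ _
    rw [sub_zero]

/-- Here `C⁺ = U * ΣV` is all of `C`, so only `C⁻` constrains the heart. -/
lemma H_eq_of_U_le_T (h : P.U ≤ P.T) : P.H = (P.S.shift (1 : ℤ)).extensionProduct P.U := by
  have hW : P.W = P.U := inf_eq_right.2 h
  rw [H, CMinus, CPlus, hW, P.isCotorsionPair_right.extensionProduct_eq_top, inf_top_eq]

lemma H_eq_of_T_le_U (h : P.T ≤ P.U) : P.H = P.T.extensionProduct (P.V.shift (-1 : ℤ)) := by
  have hW : P.W = P.T := inf_eq_left.2 h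
  rw [H, CMinus, CPlus, hW,
    P.isCotorsionPair_left.isWeakTorsionPair_shift_left.extensionProduct_eq_top, top_inf_eq]

end TwinCotorsionPair

lemma IsNestedTorsionPair.isQuasiAbelian_of_eq [IsTriangulated C] {R T U V H W : ObjectProperty C}
    (h : IsNestedTorsionPair R T U V) {A : Type u} [Category.{v} A] [Preadditive A]
    (hH : H = R.extensionProduct U) (hW : W = U) {F : H.FullSubcategory ⥤ A}
    (hF : IsIdealQuotient H W F) : IsQuasiAbelian A := by
  subst hH hW
  exact h.isQuasiAbelian hF

open CategoryTheory.Pretriangulated.Opposite in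
lemma TwinCotorsionPair.isQuasiAbelian_heart_of_T_le_U [IsTriangulated C]
    (P : TwinCotorsionPair C) (h : P.T ≤ P.U) : IsQuasiAbelian P.Heart := by
  refine IsQuasiAbelian.of_op ((P.isNestedTorsionPair_op_of_le h).isQuasiAbelian_of_eq ?_ ?_
    P.isIdealQuotient_heart.op)
  · rw [P.H_eq_of_T_le_U h, ObjectProperty.op_extensionProduct]
  · rw [TwinCotorsionPair.W, inf_eq_left.2 h]

lemma TwinCotorsionPair.isQuasiAbelian_heart_of_U_le_T [IsTriangulated C]
    (P : TwinCotorsionPair C) (h : P.U ≤ P.T) : IsQuasiAbelian P.Heart :=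
  (P.isNestedTorsionPair_of_le h).isQuasiAbelian_of_eq (P.H_eq_of_U_le_T h)
    (inf_eq_right.2 h) P.isIdealQuotient_heart

end TwinCotorsion

theorem corollary3p5 {C : Type u} [Category.{v} C] [Preadditive C] [HasZeroObject C]
    [HasShift C ℤ] [∀ n : ℤ, (shiftFunctor C n).Additive] [Pretriangulated C] [IsTriangulated C]
    (P : TwinCotorsionPair C) (h : P.U ≤ P.T ∨ P.T ≤ P.U) :
    IsQuasiAbelian P.Heart := by
  exact h.elim P.isQuasiAbelian_heart_of_U_le_T P.isQuasiAbelian_heart_of_T_le_U
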